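/- Let $(\Omega,\mathscr F,\mathsf P)$ be a probability space, $\gamma$ a random variable with values in $[0,+\infty]$ and $\mathsf P(\gamma>0)>0$. Put $G(t)=\mathsf P(\gamma\le t)$ and $\overline G(t)=1-G(t)$ for $t\in[0,\infty)$, let $dG$ be the associated measure on $[0,\infty)$ (with mass $G(0)$ at $0$), and let $t_G=\sup\{t\ge 0: G(t)<1\}$ and $\mathcal T=\{t\in[0,\infty):\mathsf P(\gamma\ge t)>0\}$. Case A means $\mathsf P(\gamma=t_G<\infty)=0$, Case B means $\mathsf P(\gamma=t_G<\infty)>0$. Let $\mathbb F=(\mathscr F_t)_{t\ge 0}$ be the single jump filtration: $\mathscr F_t$ consists of the $A\in\mathscr F$ such that $A\cap\{t<\gamma\}$ is either $\varnothing$ or $\{t<\gamma\}$ (no completion is made). A process of finite variation is an $\mathbb F$-adapted process whose almost all paths are càdlàg and of finite variation on compact intervals; it is of locally integrable variation if there are stopping times $T_n$, almost surely increasing to $\infty$, such that for every $n$ the total variation over $[0,\infty)$ of the process stopped at $T_n$, including the absolute value of its value at $0$, is integrable. A local martingale is an adapted process $M$ with almost all paths càdlàg for which there are stopping times $T_n$,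 almost surely increasing to $\infty$, such that each stopped process $M^{T_n}$ is a uniformly integrable martingale. The compensator of a process $X$ of locally integrable variation is the (up to indistinguishability unique) predictable process $A$ of locally integrable variation with $A_0=X_0$ a.s. for which $X-A$ is a local martingale. Let $V$ be a finite random variable with $\{\gamma=0\}\subseteq\{V=0\}$ and $\mathsf E(|V|\mathbf 1_{\{\gamma\le t\}})<\infty$ for all $t\in\mathcal T$. Let $K(t)=\mathsf E[V\mid\gamma=t]$, $t\in\mathcal T$, that is, $K$ is any finite Borel function that is $dG$-integrable over $[0,t]$ and satisfies $\mathsf E(V\mathbf 1_{\{\gamma\le t\}})=\int_{[0,t]}K(s)\,dG(s)$ for every $t\in\mathcal T$. Then the integral $$F(t)=\int_{(0,t]}\overline G(s-)^{-1}K(s)\,dG(s),\qquad 0\le t<t_G,$$ converges absolutely and, in Case B, the finite limit $F(t_G):=\lim_{t\uparrow t_G,\,t<t_G}F(t)$ exists; put $F(t)=F(t_G)$ for $t>t_G$ in Case B, and $F(t)=0$ for $t\ge t_G$ in Case A (these values matter only on a set of probability zero). The process $X_t=V\mathbf 1_{\{t\ge\gamma\}}$ is of locally integrable variation, and its compensator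 is $$A_t=F(t\wedge\gamma)\quad\text{in Case A},$$ $$A_t=F(t\wedge\gamma)+K(t_G)\mathbf 1_{\{\gamma\ge t_G\}}\mathbf 1_{\{t\ge t_G\}}\quad\text{in Case B}.$$ -/

import Mathlib

open MeasureTheory ProbabilityTheory Filter Topology Set
open scoped ENNReal NNReal

namespace SingleJump

section Processes

variable {Ω : Type*} {mΩ : MeasurableSpace Ω}

/-- A real function on `[0, ∞)` is càdlàg: right-continuous with finite left-hand limits. -/
def IsCadlag (f : ℝ≥0 → ℝ) : Prop :=
  (∀ t, ContinuousWithinAt f (Ici t) t) ∧ ∀ t, ∃ l : ℝ, Tendsto f (𝓝[<] t) (𝓝 l)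

/-- A process with finite variation: adapted, almost all paths being càdlàg and of finite variation
on compact intervals. -/
structure IsFiniteVariation (𝓕 : Filtration ℝ≥0 mΩ) (P : Measure Ω) (X : ℝ≥0 → Ω → ℝ) : Prop where
  adapted : StronglyAdapted 𝓕 X
  cadlag : ∀ᵐ ω ∂P, IsCadlag fun t => X t ω
  locallyBounded : ∀ᵐ ω ∂P, LocallyBoundedVariationOn (fun t => X t ω) univ

/-- A process of locally integrable variation: a process with finite variation such that, for some
localizing sequence `τ`, the total variation over `[0, ∞)` of every stopped process `X^{τ n}` (the
variation at `0` being `|X 0|`) is integrable. -/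
structure IsLocallyIntegrableVariation (𝓕 : Filtration ℝ≥0 mΩ) (P : Measure Ω)
    (X : ℝ≥0 → Ω → ℝ) : Prop extends IsFiniteVariation 𝓕 P X where
  locallyIntegrable : ∃ τ : ℕ → Ω → WithTop ℝ≥0, IsLocalizingSequence 𝓕 τ P ∧
    ∀ n, ∫⁻ ω, (‖X 0 ω‖ₑ + eVariationOn (fun t => stoppedProcess X (τ n) t ω) univ) ∂P < ∞

/-- A local martingale: an adapted process with almost all paths càdlàg such that, for some
localizing sequence `τ`, every stopped process `M^{τ n}` is a uniformly integrable martingale. -/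
structure IsLocalMartingale (𝓕 : Filtration ℝ≥0 mΩ) (P : Measure Ω) (M : ℝ≥0 → Ω → ℝ) : Prop where
  adapted : StronglyAdapted 𝓕 M
  cadlag : ∀ᵐ ω ∂P, IsCadlag fun t => M t ω
  localized : ∃ τ : ℕ → Ω → WithTop ℝ≥0, IsLocalizingSequence 𝓕 τ P ∧
    ∀ n, Martingale (stoppedProcess M (τ n)) 𝓕 P ∧ UniformIntegrable (stoppedProcess M (τ n)) 1 P

/-- `A` is the compensator of the process `X` of locally integrable variation: `A` is a predictable
process of locally integrable variation such that `X - A` is a local martingale starting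
from `0`. (These properties determine `A` up to indistinguishability.) -/
structure IsCompensator (𝓕 : Filtration ℝ≥0 mΩ) (P : Measure Ω) (X A : ℝ≥0 → Ω → ℝ) : Prop where
  process : IsLocallyIntegrableVariation 𝓕 P X
  predictable : IsStronglyPredictable 𝓕 A
  variation : IsLocallyIntegrableVariation 𝓕 P A
  initial : ∀ᵐ ω ∂P, A 0 ω = X 0 ω
  localMartingale : IsLocalMartingale 𝓕 P fun t ω => X t ω - A t ω

end Processes

section Model

variable {Ω : Type*} {mΩ : MeasurableSpace Ω}

/-- The single jump filtration generated by `γ`: the `σ`-field at time `t` consists of the measurable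
sets `A` such that `A ∩ {t < γ}` is either empty or the whole of `{t < γ}`. -/
def filtration (γ : Ω → ℝ≥0∞) : Filtration ℝ≥0 mΩ where
  seq t :=
    { MeasurableSet' := fun A => MeasurableSet A ∧
        (A ∩ {ω | (t : ℝ≥0∞) < γ ω} = ∅ ∨ A ∩ {ω | (t : ℝ≥0∞) < γ ω} = {ω | (t : ℝ≥0∞) < γ ω})
      measurableSet_empty := ⟨MeasurableSet.empty, Or.inl (empty_inter _)⟩
      measurableSet_compl := by
        rintro A ⟨hA, h | h⟩
        · refine ⟨hA.compl, Or.inr ?_⟩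
          rw [inter_eq_right]
          exact fun ω hω hωA => (h ▸ (⟨hωA, hω⟩ : ω ∈ A ∩ _) : ω ∈ (∅ : Set Ω))
        · refine ⟨hA.compl, Or.inl ?_⟩
          rw [inter_eq_right] at h
          exact eq_empty_of_forall_notMem fun ω hω => hω.1 (h hω.2)
      measurableSet_iUnion := by
        intro f hf
        refine ⟨MeasurableSet.iUnion fun i => (hf i).1, ?_⟩
        by_cases h : ∃ i, f i ∩ {ω | (t : ℝ≥0∞) < γ ω} = {ω | (t : ℝ≥0∞) < γ ω}
        · obtain ⟨i, hi⟩ := h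
          refine Or.inr ?_
          rw [inter_eq_right] at hi ⊢
          exact hi.trans (subset_iUnion f i)
        · refine Or.inl ?_
          rw [iUnion_inter, iUnion_eq_empty]
          exact fun i => (hf i).2.resolve_right fun hi => h ⟨i, hi⟩ }
  mono' := by
    intro s t hst A hA
    have hsub : {ω | (t : ℝ≥0∞) < γ ω} ⊆ {ω | (s : ℝ≥0∞) < γ ω} := fun ω hω =>
      lt_of_le_of_lt (ENNReal.coe_le_coe.2 hst) hω
    refine ⟨hA.1, hA.2.imp (fun h => ?_) fun h => ?_⟩
    · exact subset_eq_empty (inter_subset_inter_right A hsub) h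
    · rw [inter_eq_right] at h ⊢
      exact hsub.trans h
  le' := fun _ _ hA => hA.1

/-- The distribution function `G(t) = P(γ ≤ t)`, `0 ≤ t < ∞`. -/
noncomputable def G (P : Measure Ω) (γ : Ω → ℝ≥0∞) (t : ℝ≥0) : ℝ :=
  P.real {ω | γ ω ≤ t}

/-- `1 - G`. -/
noncomputable def Gbar (P : Measure Ω) (γ : Ω → ℝ≥0∞) (t : ℝ≥0) : ℝ :=
  1 - G P γ t

/-- The measure `dG` on `[0, ∞)`, with mass `G 0` at `0`: the law of `γ` restricted to finite
values. -/
noncomputable def dG (P : Measure Ω) (γ : Ω → ℝ≥0∞) : Measure ℝ≥0 :=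
  (P.map γ).comap fun t : ℝ≥0 => (t : ℝ≥0∞)

/-- The right endpoint `t_G = sup {t : G t < 1}`, an element of `[0, ∞]`. -/
noncomputable def endpoint (P : Measure Ω) (γ : Ω → ℝ≥0∞) : ℝ≥0∞ :=
  sSup ((fun t : ℝ≥0 => (t : ℝ≥0∞)) '' {t | G P γ t < 1})

/-- The set `𝒯` of the `t ∈ [0, ∞)` with `P(γ ≥ t) > 0`. -/
def timeSet (P : Measure Ω) (γ : Ω → ℝ≥0∞) : Set ℝ≥0 :=
  {t | 0 < P {ω | (t : ℝ≥0∞) ≤ γ ω}}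

/-- Case A: `P(γ = t_G < ∞) = 0`. -/
def CaseA (P : Measure Ω) (γ : Ω → ℝ≥0∞) : Prop :=
  P {ω | γ ω = endpoint P γ ∧ endpoint P γ < ∞} = 0

/-- Case B: `P(γ = t_G < ∞) > 0`. -/
def CaseB (P : Measure Ω) (γ : Ω → ℝ≥0∞) : Prop :=
  0 < P {ω | γ ω = endpoint P γ ∧ endpoint P γ < ∞}

/-- `K(t) = E[V | γ = t]` for `t ∈ 𝒯`, that is, `K` is a Borel function, `dG`-integrable over `[0, t]`
for `t ∈ 𝒯`, with `E(V 1_{γ ≤ t}) = ∫_{[0, t]} K dG` for `t ∈ 𝒯`. -/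
structure IsCondExpGiven (P : Measure Ω) (γ : Ω → ℝ≥0∞) (V : Ω → ℝ) (K : ℝ≥0 → ℝ) : Prop where
  measurable : Measurable K
  integrableOn : ∀ t ∈ timeSet P γ, IntegrableOn K (Iic t) (dG P γ)
  setIntegral_eq : ∀ t ∈ timeSet P γ,
    ∫ ω in {ω | γ ω ≤ t}, V ω ∂P = ∫ s in Iic t, K s ∂(dG P γ)

/-- `dG` has distribution function `G`. -/
theorem dG_Iic (P : Measure Ω)
    {γ : Ω → ℝ≥0∞} (hγ : Measurable γ) (t : ℝ≥0) : dG P γ (Iic t) = P {ω | γ ω ≤ t} := by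
  have he : MeasurableEmbedding (fun t : ℝ≥0 => (t : ℝ≥0∞)) :=
    ENNReal.isOpenEmbedding_coe.measurableEmbedding
  have hi : (fun t : ℝ≥0 => (t : ℝ≥0∞)) '' (Iic t) = Iic (t : ℝ≥0∞) := by
    ext x
    constructor
    · rintro ⟨y, hy, rfl⟩
      exact ENNReal.coe_le_coe.2 hy
    · intro hx
      lift x to ℝ≥0 using ne_top_of_le_ne_top ENNReal.coe_ne_top hx
      exact ⟨x, ENNReal.coe_le_coe.1 hx, rfl⟩
  rw [dG, he.comap_apply, hi, Measure.map_apply hγ measurableSet_Iic]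
  rfl

theorem exists_density (P : Measure Ω) [IsProbabilityMeasure P]
    {γ : Ω → ℝ≥0∞} (hγ : Measurable γ) (f : Ω → ℝ≥0) :
    ∃ k : ℝ≥0 → ℝ≥0∞, Measurable k ∧
      ∀ t : ℝ≥0, ∫⁻ s in Iic t, k s ∂(dG P γ) = ∫⁻ ω in {ω | γ ω ≤ t}, f ω ∂P := by
  have he : MeasurableEmbedding (fun t : ℝ≥0 => (t : ℝ≥0∞)) :=
    ENNReal.isOpenEmbedding_coe.measurableEmbedding
  set ν : Measure Ω := P.withDensity fun ω => (f ω : ℝ≥0∞) with hν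
  have hfin : IsFiniteMeasure (dG P γ) := by
    constructor
    rw [dG, he.comap_apply]
    have := Measure.isProbabilityMeasure_map (μ := P) hγ.aemeasurable
    exact measure_lt_top _ _
  have hsf : SFinite ν := inferInstanceAs (SFinite (P.withDensity _))
  have hac : dG ν γ ≪ dG P γ := by
    intro s hs
    rw [dG, he.comap_apply] at hs ⊢
    exact ((withDensity_absolutelyContinuous P _).map hγ) hs
  have : SFinite (dG ν γ) := by
    have : dG ν γ = (((ν.map γ).restrict {⊤}ᶜ).map ENNReal.toNNReal) := by
      ext s hs
      rw [dG, he.comap_apply, Measure.map_apply ENNReal.measurable_toNNReal hs,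
        Measure.restrict_apply (ENNReal.measurable_toNNReal hs)]
      congr 1
      ext x
      constructor
      · rintro ⟨y, hy, rfl⟩
        simpa using hy
      · rintro ⟨h1, h2⟩
        exact ⟨x.toNNReal, h1, ENNReal.coe_toNNReal h2⟩
    rw [this]
    infer_instance
  refine ⟨(dG ν γ).rnDeriv (dG P γ), Measure.measurable_rnDeriv _ _, fun t => ?_⟩
  have h := Measure.withDensity_rnDeriv_eq (dG ν γ) (dG P γ) hac
  rw [← withDensity_apply _ measurableSet_Iic, h, dG_Iic ν hγ, hν,
    withDensity_apply _ (measurableSet_le hγ measurable_const)]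

/-- The function `K(t) = E[V | γ = t]` exists. -/
theorem exists_isCondExpGiven (P : Measure Ω)
    [IsProbabilityMeasure P]
    {γ : Ω → ℝ≥0∞} (hγ : Measurable γ) {V : Ω → ℝ}
    (hV_int : ∀ t ∈ timeSet P γ, IntegrableOn V {ω | γ ω ≤ t} P) :
    ∃ K, IsCondExpGiven P γ V K := by
  obtain ⟨k, hk, hkt⟩ := exists_density P hγ fun ω => (V ω).toNNReal
  obtain ⟨l, hl, hlt⟩ := exists_density P hγ fun ω => (-V ω).toNNReal
  have key : ∀ (W : Ω → ℝ) (m : ℝ≥0 → ℝ≥0∞) (t : ℝ≥0), IntegrableOn W {ω | γ ω ≤ t} P →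
      Measurable m →
      ∫⁻ s in Iic t, m s ∂(dG P γ) = ∫⁻ ω in {ω | γ ω ≤ t}, (W ω).toNNReal ∂P →
      IntegrableOn (fun s => (m s).toReal) (Iic t) (dG P γ) ∧
      ∫ s in Iic t, (m s).toReal ∂(dG P γ)
        = (∫⁻ ω in {ω | γ ω ≤ t}, (W ω).toNNReal ∂P).toReal := by
    intro W m t hW hm hmt
    have hlt : ∫⁻ s in Iic t, m s ∂(dG P γ) ≠ ∞ := by
      rw [hmt]
      refine ne_top_of_le_ne_top hW.2.ne (lintegral_mono fun ω => ?_)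
      rw [← ofReal_norm]
      exact ENNReal.ofReal_le_ofReal (le_abs_self _)
    refine ⟨integrable_toReal_of_lintegral_ne_top hm.aemeasurable hlt, ?_⟩
    rw [integral_toReal hm.aemeasurable (ae_lt_top hm hlt), hmt]
  refine ⟨fun s => (k s).toReal - (l s).toReal, hk.ennreal_toReal.sub hl.ennreal_toReal, ?_, ?_⟩
  · intro t ht
    exact (key V k t (hV_int t ht) hk (hkt t)).1.sub (key _ l t (hV_int t ht).neg hl (hlt t)).1
  · intro t ht
    have h1 := key V k t (hV_int t ht) hk (hkt t)
    have h2 := key _ l t (hV_int t ht).neg hl (hlt t)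
    rw [integral_sub h1.1 h2.1, h1.2, h2.2, integral_eq_lintegral_pos_part_sub_lintegral_neg_part
      (hV_int t ht)]
    rfl

/-- The integral `∫_{(0, t]} Ḡ(s-)⁻¹ K(s) dG(s)`. -/
noncomputable def primitive (P : Measure Ω) (γ : Ω → ℝ≥0∞) (K : ℝ≥0 → ℝ) (t : ℝ≥0) : ℝ :=
  ∫ s in Ioc 0 t, (Function.leftLim (Gbar P γ) s)⁻¹ * K s ∂(dG P γ)

open Classical in
/-- The function `F`: it equals `∫_{(0, t]} Ḡ(s-)⁻¹ K(s) dG(s)` for `t < t_G` and, in Case B, its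
left-hand limit at `t_G` for `t = t_G`. Since `P(γ > t_G) = 0`, and `P(γ ≥ t_G) = 0` in Case A when
`t_G < ∞`, the other values of `F` are immaterial: `F` is taken constant on `[t_G, ∞)`, with
value `0` in Case A. -/
noncomputable def F (P : Measure Ω) (γ : Ω → ℝ≥0∞) (K : ℝ≥0 → ℝ) (t : ℝ≥0) : ℝ :=
  if (t : ℝ≥0∞) < endpoint P γ then primitive P γ K t
  else if CaseB P γ then limUnder (𝓝[<] (endpoint P γ).toNNReal) (primitive P γ K)
  else 0

/-- The single jump process `V 1_{t ≥ γ}`. -/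
noncomputable def jumpProcess (γ : Ω → ℝ≥0∞) (V : Ω → ℝ) (t : ℝ≥0) (ω : Ω) : ℝ :=
  {ω | γ ω ≤ t}.indicator V ω

/-- The process `F(t ∧ γ)`. -/
noncomputable def compensatorA (P : Measure Ω) (γ : Ω → ℝ≥0∞) (K : ℝ≥0 → ℝ)
    (t : ℝ≥0) (ω : Ω) : ℝ :=
  F P γ K (min (t : ℝ≥0∞) (γ ω)).toNNReal

/-- The process `F(t ∧ γ) + K(t_G) 1_{γ ≥ t_G} 1_{t ≥ t_G}`. -/
noncomputable def compensatorB (P : Measure Ω) (γ : Ω → ℝ≥0∞) (K : ℝ≥0 → ℝ)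
    (t : ℝ≥0) (ω : Ω) : ℝ :=
  F P γ K (min (t : ℝ≥0∞) (γ ω)).toNNReal +
    K (endpoint P γ).toNNReal * {ω | endpoint P γ ≤ γ ω}.indicator 1 ω *
      {s : ℝ≥0 | endpoint P γ ≤ s}.indicator 1 t

end Model

end SingleJump

/-! Since `Ḡ(s-) = P(γ ≥ s)`, Fubini's theorem gives, for `t ∈ 𝒯`, that the mean of `∫_{(0, t ∧ γ]}
Ḡ(s-)⁻¹ K(s) dG(s)` is `∫_{(0, t]} Ḡ(s-)⁻¹ K(s) P(γ ≥ s) dG(s) = ∫_{(0, t]} K dG`, which is also the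
mean of `X_t`. So `M = X - A` has mean zero at all times of `𝒯`.

In the single jump filtration this already makes `M` a martingale up to any `u ∈ 𝒯`. For `s ≤ u` the
increment `M_u - M_s` vanishes on `{γ ≤ s}`, while a set of the `σ`-field at time `s` either
contains `{s < γ}` or misses it. The integral of the increment over such a set is therefore its full
mean or `0` (`ae_eq_condExp_of_integral_eq_zero`).

To localize, a sequence cofinal in `𝒯` is turned into the stopping times `cutTime`. All processes
here are constant after the jump, so stopping them at `cutTime γ u` is stopping at the constant `u`;
almost surely every time up to `γ` lies in `𝒯`, so these times increase to `∞`.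

Both cases are instances of `isCompensator_comp_min`, for a Borel `H` that equals the primitive on
`𝒯`. In Case A, `𝒯` lies below `t_G` and `H = F`. In Case B, `t_G ∈ 𝒯` and `dG` has at `t_G` an atom
of mass `P(γ ≥ t_G)`, so the primitive jumps there by exactly `K(t_G)`. -/

namespace SingleJump

/-! ### Indefinite integrals: path regularity and variation -/

section Primitives

variable {μ : Measure ℝ≥0} {k : ℝ≥0 → ℝ}

/-- Continuity from the right of an indefinite integral. -/
theorem continuousWithinAt_setIntegral_Ioc {a b : ℝ≥0} (hab : a < b)
    (hk : IntegrableOn k (Ioc 0 b) μ) :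
    ContinuousWithinAt (fun t => ∫ s in Ioc 0 t, k s ∂μ) (Ici a) a := by
  have hev : ∀ᶠ t in 𝓝[≥] a, t ∈ Ico a b := Ico_mem_nhdsGE hab
  simp_rw [← integral_indicator (measurableSet_Ioc (α := ℝ≥0))]
  rw [← integrable_indicator_iff measurableSet_Ioc] at hk
  refine tendsto_integral_filter_of_dominated_convergence (fun s => ‖(Ioc 0 b).indicator k s‖)
    ?_ ?_ hk.norm ?_
  · filter_upwards [hev] with t ht
    have : (Ioc 0 t).indicator k = (Ioc 0 t).indicator ((Ioc 0 b).indicator k) := by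
      rw [indicator_indicator, inter_eq_left.2 (Ioc_subset_Ioc_right ht.2.le)]
    rw [this]
    exact hk.aestronglyMeasurable.indicator measurableSet_Ioc
  · filter_upwards [hev] with t ht
    exact ae_of_all _ fun s =>
      norm_indicator_le_of_subset (Ioc_subset_Ioc_right ht.2.le) _ _
  · refine ae_of_all _ fun s => tendsto_const_nhds.congr' ?_
    rcases le_or_gt s a with hs | hs
    · filter_upwards [self_mem_nhdsWithin] with t ht
      simp [indicator_apply, hs, hs.trans ht]
    · filter_upwards [mem_nhdsWithin_of_mem_nhds (Iio_mem_nhds hs)] with t ht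
      simp [hs.not_ge, not_le.2 (mem_Iio.1 ht)]

/-- The left-hand limit of an indefinite integral. -/
theorem tendsto_setIntegral_Ioc_left {a : ℝ≥0} (hk : IntegrableOn k (Ioc 0 a) μ) :
    Tendsto (fun t => ∫ s in Ioc 0 t, k s ∂μ) (𝓝[<] a) (𝓝 (∫ s in Ioo 0 a, k s ∂μ)) := by
  have hev : ∀ᶠ t in 𝓝[<] a, t < a := self_mem_nhdsWithin
  simp_rw [← integral_indicator (measurableSet_Ioc (α := ℝ≥0)),
    ← integral_indicator (measurableSet_Ioo (α := ℝ≥0))]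
  rw [← integrable_indicator_iff measurableSet_Ioc] at hk
  refine tendsto_integral_filter_of_dominated_convergence (fun s => ‖(Ioc 0 a).indicator k s‖)
    ?_ ?_ hk.norm ?_
  · filter_upwards [hev] with t ht
    have : (Ioc 0 t).indicator k = (Ioc 0 t).indicator ((Ioc 0 a).indicator k) := by
      rw [indicator_indicator, inter_eq_left.2 (Ioc_subset_Ioc_right ht.le)]
    rw [this]
    exact hk.aestronglyMeasurable.indicator measurableSet_Ioc
  · filter_upwards [hev] with t ht
    exact ae_of_all _ fun s => norm_indicator_le_of_subset (Ioc_subset_Ioc_right ht.le) _ _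
  · refine ae_of_all _ fun s => tendsto_const_nhds.congr' ?_
    rcases lt_or_ge s a with hs | hs
    · filter_upwards [mem_nhdsWithin_of_mem_nhds (Ioi_mem_nhds hs)] with t ht
      simp [indicator_apply, hs, le_of_lt (mem_Ioi.1 ht)]
    · filter_upwards [hev] with t ht
      simp [hs.not_gt, not_le.2 (ht.trans_le hs)]

theorem isCadlag_setIntegral_Ioc (hk : ∀ t, IntegrableOn k (Ioc 0 t) μ) :
    IsCadlag fun t => ∫ s in Ioc 0 t, k s ∂μ :=
  ⟨fun t => continuousWithinAt_setIntegral_Ioc (lt_add_one t) (hk _),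
    fun t => ⟨_, tendsto_setIntegral_Ioc_left (hk t)⟩⟩

theorem edist_setIntegral_Ioc_le {a b : ℝ≥0} (hab : a ≤ b) (hk : IntegrableOn k (Ioc 0 b) μ) :
    edist (∫ s in Ioc 0 b, k s ∂μ) (∫ s in Ioc 0 a, k s ∂μ) ≤ ∫⁻ s in Ioc a b, ‖k s‖ₑ ∂μ := by
  rw [← Ioc_union_Ioc_eq_Ioc (zero_le (a := a)) hab] at hk ⊢
  rw [setIntegral_union (Ioc_disjoint_Ioc_of_le le_rfl) measurableSet_Ioc
    hk.left_of_union hk.right_of_union, edist_eq_enorm_sub, add_sub_cancel_left]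
  exact enorm_integral_le_lintegral_enorm _

/-- The variation of an indefinite integral is at most the integral of the absolute value. -/
theorem eVariationOn_setIntegral_Ioc_le (hk : ∀ t, IntegrableOn k (Ioc 0 t) μ) {S T : Set ℝ≥0}
    (hST : ∀ a ∈ S, ∀ b ∈ S, Ioc a b ⊆ T) :
    eVariationOn (fun t => ∫ s in Ioc 0 t, k s ∂μ) S ≤ ∫⁻ s in T, ‖k s‖ₑ ∂μ := by
  refine iSup_le ?_
  rintro ⟨n, u, hu, huS⟩
  have key : ∀ m, ∑ i ∈ Finset.range m, ∫⁻ s in Ioc (u i) (u (i + 1)), ‖k s‖ₑ ∂μ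
      = ∫⁻ s in Ioc (u 0) (u m), ‖k s‖ₑ ∂μ := by
    intro m
    induction m with
    | zero => simp
    | succ m ih =>
      rw [Finset.sum_range_succ, ih, ← lintegral_union measurableSet_Ioc
        (Ioc_disjoint_Ioc_of_le le_rfl), Ioc_union_Ioc_eq_Ioc (hu (Nat.zero_le m))
        (hu (Nat.le_succ m))]
  calc _ ≤ ∑ i ∈ Finset.range n, ∫⁻ s in Ioc (u i) (u (i + 1)), ‖k s‖ₑ ∂μ :=
        Finset.sum_le_sum fun i _ => edist_setIntegral_Ioc_le (hu (Nat.le_succ i)) (hk _)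
    _ = _ := key n
    _ ≤ _ := lintegral_mono_set (hST _ (huS 0) _ (huS n))

theorem locallyBoundedVariationOn_setIntegral_Ioc (hk : ∀ t, IntegrableOn k (Ioc 0 t) μ) :
    LocallyBoundedVariationOn (fun t => ∫ s in Ioc 0 t, k s ∂μ) univ := by
  intro a b _ _
  refine ne_top_of_le_ne_top (hk b).2.ne (eVariationOn_setIntegral_Ioc_le hk ?_)
  exact fun x _ y hy => Ioc_subset_Ioc zero_le hy.2.2

/-- Bounds the total variation of a path stopped at `u`: it is a monotone reparametrization of the
path on `[0, u]`. -/
theorem eVariationOn_setIntegral_Ioc_min_le (hk : ∀ t, IntegrableOn k (Ioc 0 t) μ) (u : ℝ≥0) :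
    eVariationOn (fun t => ∫ s in Ioc 0 (min t u), k s ∂μ) univ
      ≤ ∫⁻ s in Ioc 0 u, ‖k s‖ₑ ∂μ := by
  refine (eVariationOn.comp_le_of_monotoneOn (fun t => ∫ s in Ioc 0 t, k s ∂μ) (s := Iic u)
    (fun t => min t u) (fun x _ y _ h => min_le_min_right u h)
    fun x _ => mem_Iic.2 (min_le_right x u)).trans ?_
  exact eVariationOn_setIntegral_Ioc_le hk fun x _ y hy => Ioc_subset_Ioc zero_le hy

end Primitives

/-! ### The single jump filtration, predictability and localizing times -/

section Filtration

variable {Ω : Type*} {mΩ : MeasurableSpace Ω} {P : Measure Ω} {γ : Ω → ℝ≥0∞}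

theorem measurableSet_filtration_lt (hγ : Measurable γ) (t : ℝ≥0) :
    MeasurableSet[filtration (mΩ := mΩ) γ t] {ω | (t : ℝ≥0∞) < γ ω} :=
  ⟨measurableSet_lt measurable_const hγ, Or.inr (inter_self _)⟩

/-- On `{t < γ}` the process is the constant `0`, so a preimage contains that event or misses it. -/
theorem stronglyAdapted_jumpProcess (hγ : Measurable γ) {V : Ω → ℝ} (hV : Measurable V) :
    StronglyAdapted (filtration (mΩ := mΩ) γ) (jumpProcess γ V) := by
  intro t
  refine Measurable.stronglyMeasurable fun B hB => ⟨?_, ?_⟩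
  · exact (hV.indicator (measurableSet_le hγ measurable_const)) hB
  · have h0 : ∀ ω, (t : ℝ≥0∞) < γ ω → jumpProcess γ V t ω = 0 := fun ω hω =>
      indicator_of_notMem (s := {ω | γ ω ≤ t}) hω.not_ge V
    by_cases h : (0 : ℝ) ∈ B
    · refine Or.inr (inter_eq_right.2 fun ω hω => ?_)
      rw [mem_preimage, h0 ω hω]
      exact h
    · refine Or.inl (eq_empty_of_forall_notMem fun ω hω => h ?_)
      rw [← h0 ω hω.2]
      exact hω.1

/-- The process `t ∧ γ` is predictable. -/
theorem measurable_predictable_min (hγ : Measurable γ) :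
    Measurable[(filtration (mΩ := mΩ) γ).predictable]
      fun p : ℝ≥0 × Ω => (min (p.1 : ℝ≥0∞) (γ p.2)).toNNReal := by
  let _ := (filtration (mΩ := mΩ) γ).predictable
  refine measurable_of_Ioi fun s => ?_
  -- `{t ∧ γ > s}` is the rectangle `(s, ∞) × {s < γ}`, whose base belongs to the `σ`-field at time
  -- `s`.
  convert measurableSet_predictable_Ioi_prod (measurableSet_filtration_lt hγ s) using 1
  ext ⟨t, ω⟩
  have : min (t : ℝ≥0∞) (γ ω) ≠ ∞ := ne_top_of_le_ne_top ENNReal.coe_ne_top (min_le_left _ _)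
  simp only [mem_preimage, mem_Ioi, mem_prod, mem_ofPred_eq]
  rw [← ENNReal.coe_lt_coe, ENNReal.coe_toNNReal this, lt_min_iff, ENNReal.coe_lt_coe]

theorem isStronglyPredictable_comp_min (hγ : Measurable γ) {H : ℝ≥0 → ℝ} (hH : Measurable H) :
    IsStronglyPredictable (filtration (mΩ := mΩ) γ) fun t ω => H (min (t : ℝ≥0∞) (γ ω)).toNNReal := by
  let _ := (filtration (mΩ := mΩ) γ).predictable
  exact (hH.comp (measurable_predictable_min hγ)).stronglyMeasurable

/-- The time which is `u` if the jump occurs after `u`, and `∞` otherwise. -/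
noncomputable def cutTime (γ : Ω → ℝ≥0∞) (u : ℝ≥0) (ω : Ω) : WithTop ℝ≥0 :=
  {ω | (u : ℝ≥0∞) < γ ω}.piecewise (fun _ => (u : WithTop ℝ≥0)) (fun _ => ⊤) ω

theorem cutTime_of_lt {u : ℝ≥0} {ω : Ω} (h : (u : ℝ≥0∞) < γ ω) : cutTime γ u ω = u :=
  piecewise_eq_of_mem {ω | (u : ℝ≥0∞) < γ ω} _ _ h

theorem cutTime_of_le {u : ℝ≥0} {ω : Ω} (h : γ ω ≤ u) : cutTime γ u ω = ⊤ :=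
  piecewise_eq_of_notMem {ω | (u : ℝ≥0∞) < γ ω} _ _ h.not_gt

theorem isStoppingTime_cutTime (hγ : Measurable γ) (u : ℝ≥0) :
    IsStoppingTime (filtration (mΩ := mΩ) γ) (cutTime γ u) := by
  intro t
  by_cases hut : u ≤ t
  · convert (filtration (mΩ := mΩ) γ).mono hut _ (measurableSet_filtration_lt hγ u) using 1
    ext ω
    rcases lt_or_ge (u : ℝ≥0∞) (γ ω) with h | h
    · exact iff_of_true ((cutTime_of_lt h).trans_le (WithTop.coe_le_coe.2 hut)) h
    · exact iff_of_false (fun h' => WithTop.not_top_le_coe t ((cutTime_of_le h).symm.trans_le h'))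
        h.not_gt
  · convert MeasurableSet.empty using 1
    refine eq_empty_of_forall_notMem fun ω h' => ?_
    rcases lt_or_ge (u : ℝ≥0∞) (γ ω) with h | h
    · exact hut (WithTop.coe_le_coe.1 ((cutTime_of_lt h).symm.trans_le h'))
    · exact WithTop.not_top_le_coe t ((cutTime_of_le h).symm.trans_le h')

/-- Stopping a process that is constant from the jump on at `cutTime γ u` amounts to stopping it
at the constant time `u`. -/
theorem stoppedProcess_cutTime {Y : ℝ≥0 → Ω → ℝ} {u : ℝ≥0}
    (hY : ∀ t ω, γ ω ≤ u → Y t ω = Y (min t u) ω) :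
    stoppedProcess Y (cutTime γ u) = fun t => Y (min t u) := by
  ext t ω
  rcases lt_or_ge (u : ℝ≥0∞) (γ ω) with h | h
  · rw [stoppedProcess, cutTime_of_lt h, ← WithTop.coe_min, WithTop.untopA_eq_untop WithTop.coe_ne_top, WithTop.untop_coe]
  · rw [stoppedProcess, cutTime_of_le h, min_top_right, WithTop.untopA_eq_untop WithTop.coe_ne_top, WithTop.untop_coe, hY t ω h]

theorem isLocalizingSequence_cutTime (hγ : Measurable γ) {t : ℕ → ℝ≥0} (ht : Monotone t)
    (h : ∀ᵐ ω ∂P, ∀ s : ℝ≥0, (s : ℝ≥0∞) ≤ γ ω → ∃ n, s ≤ t n) :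
    IsLocalizingSequence (filtration (mΩ := mΩ) γ) (fun n => cutTime γ (t n)) P where
  isStoppingTime n := isStoppingTime_cutTime hγ _
  mono := by
    refine ae_of_all _ fun ω m n hmn => ?_
    dsimp only
    rcases lt_or_ge (t n : ℝ≥0∞) (γ ω) with h | h
    · rw [cutTime_of_lt h,
        cutTime_of_lt ((ENNReal.coe_le_coe.2 (ht hmn)).trans_lt h)]
      exact WithTop.coe_le_coe.2 (ht hmn)
    · rw [cutTime_of_le h]
      exact le_top
  tendsto_top := by
    filter_upwards [h] with ω hω
    refine tendsto_order.2 ⟨fun a ha => ?_, fun a ha => absurd ha not_top_lt⟩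
    lift a to ℝ≥0 using ha.ne
    -- Either the jump has occurred by `t n`, and the cut time is `∞` from then on, or `t n` itself
    -- has passed `a`.
    obtain ⟨n, hn⟩ : ∃ n, γ ω ≤ t n ∨ a < t n := by
      rcases eq_or_ne (γ ω) ∞ with h | h
      · obtain ⟨n, hn⟩ := hω (a + 1) (by simp [h])
        exact ⟨n, Or.inr (lt_of_lt_of_le (lt_add_one a) hn)⟩
      · obtain ⟨n, hn⟩ := hω (γ ω).toNNReal (by rw [ENNReal.coe_toNNReal h])
        exact ⟨n, Or.inl (by rwa [← ENNReal.coe_le_coe, ENNReal.coe_toNNReal h] at hn)⟩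
    filter_upwards [eventually_ge_atTop n] with m hm
    rcases lt_or_ge (t m : ℝ≥0∞) (γ ω) with h | h
    · rw [cutTime_of_lt h, WithTop.coe_lt_coe]
      refine (hn.resolve_left fun h' => ?_).trans_le (ht hm)
      exact (h.trans_le h').not_ge (ENNReal.coe_le_coe.2 (ht hm))
    · rwa [cutTime_of_le h]

end Filtration

/-! ### The law of `γ`: the set `𝒯`, the left limits of `Ḡ` and the right endpoint -/

section Law

variable {Ω : Type*} {mΩ : MeasurableSpace Ω} {P : Measure Ω} {γ : Ω → ℝ≥0∞}

theorem mem_timeSet_of_le {s t : ℝ≥0} (hst : s ≤ t) (ht : t ∈ timeSet P γ) : s ∈ timeSet P γ :=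
  lt_of_lt_of_le ht (measure_mono fun _ hω => (ENNReal.coe_le_coe.2 hst).trans hω)

theorem zero_mem_timeSet [IsProbabilityMeasure P] : 0 ∈ timeSet P γ := by
  simp [timeSet]

theorem measureReal_le_pos [IsProbabilityMeasure P] {t : ℝ≥0} (ht : t ∈ timeSet P γ) :
    0 < P.real {ω | (t : ℝ≥0∞) ≤ γ ω} :=
  ENNReal.toReal_pos (ne_of_gt ht) (measure_ne_top _ _)

/-- Almost surely, all times up to the jump belong to `timeSet P γ`. -/
theorem ae_forall_le_mem_timeSet :
    ∀ᵐ ω ∂P, ∀ s : ℝ≥0, (s : ℝ≥0∞) ≤ γ ω → s ∈ timeSet P γ := by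
  have hord : OrdConnected (timeSet P γ)ᶜ :=
    ⟨fun x hx _ _ z hz hz' => hx (mem_timeSet_of_le hz.1 hz')⟩
  rcases isEmpty_or_nonempty ↥(timeSet P γ)ᶜ with h | h
  · exact ae_of_all _ fun ω s _ => by_contra fun hs => h.elim ⟨s, hs⟩
  -- The complement of `𝒯` is an up-set; a sequence coinitial in it reduces the claim to countably
  -- many null events `{u n ≤ γ}`.
  · obtain ⟨u, -, hu⟩ := exists_seq_antitone_tendsto_atTop_atBot ↥(timeSet P γ)ᶜ
    have h0 : ∀ n, ∀ᵐ ω ∂P, ¬ (((u n : ℝ≥0) : ℝ≥0∞) ≤ γ ω) := fun n =>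
      measure_eq_zero_iff_ae_notMem.1 (not_not.1 fun h => (u n).2 (pos_iff_ne_zero.2 h))
    filter_upwards [ae_all_iff.2 h0] with ω hω s hs
    by_contra hsT
    obtain ⟨n, hn⟩ := (hu.eventually (eventually_le_atBot ⟨s, hsT⟩)).exists
    exact hω n ((ENNReal.coe_le_coe.2 hn).trans hs)

/-- `timeSet P γ` has a cofinal increasing sequence. -/
theorem exists_monotone_cofinal_timeSet [IsProbabilityMeasure P] :
    ∃ t : ℕ → ℝ≥0, Monotone t ∧ (∀ n, t n ∈ timeSet P γ) ∧
      ∀ s ∈ timeSet P γ, ∃ n, s ≤ t n := by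
  have hord : OrdConnected (timeSet P γ) :=
    ⟨fun _ _ y hy z hz => mem_timeSet_of_le hz.2 hy⟩
  have : Nonempty ↥(timeSet P γ) := ⟨0, zero_mem_timeSet⟩
  obtain ⟨u, hmono, hu⟩ := exists_seq_monotone_tendsto_atTop_atTop ↥(timeSet P γ)
  refine ⟨fun n => u n, fun m n hmn => hmono hmn, fun n => (u n).2, fun s hs => ?_⟩
  obtain ⟨n, hn⟩ := (hu.eventually (eventually_ge_atTop ⟨s, hs⟩)).exists
  exact ⟨n, hn⟩

theorem isFiniteMeasure_dG [IsProbabilityMeasure P] (hγ : Measurable γ) :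
    IsFiniteMeasure (dG P γ) := by
  constructor
  rw [dG, ENNReal.isOpenEmbedding_coe.measurableEmbedding.comap_apply]
  have := Measure.isProbabilityMeasure_map (μ := P) hγ.aemeasurable
  exact measure_lt_top _ _

theorem dG_singleton (hγ : Measurable γ) (t : ℝ≥0) : dG P γ {t} = P {ω | γ ω = t} := by
  rw [dG, ENNReal.isOpenEmbedding_coe.measurableEmbedding.comap_apply, image_singleton,
    Measure.map_apply hγ (measurableSet_singleton _)]
  rfl

theorem Gbar_eq [IsProbabilityMeasure P] (hγ : Measurable γ) (t : ℝ≥0) :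
    Gbar P γ t = P.real {ω | (t : ℝ≥0∞) < γ ω} := by
  have : {ω | (t : ℝ≥0∞) < γ ω} = {ω | γ ω ≤ t}ᶜ := by ext; simp
  rw [this, probReal_compl_eq_one_sub (measurableSet_le hγ measurable_const)]
  rfl

theorem antitone_Gbar [IsProbabilityMeasure P] (hγ : Measurable γ) : Antitone (Gbar P γ) := by
  intro s t hst
  rw [Gbar_eq hγ, Gbar_eq hγ]
  exact measureReal_mono fun ω hω => (ENNReal.coe_le_coe.2 hst).trans_lt hω

/-- Dominated convergence: the indicators of `{s < γ}` tend to that of `{t ≤ γ}` as `s ↑ t`.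
Positivity of `t` makes the left neighbourhood nontrivial. -/
theorem leftLim_Gbar [IsProbabilityMeasure P] (hγ : Measurable γ) {t : ℝ≥0} (ht : 0 < t) :
    Function.leftLim (Gbar P γ) t = P.real {ω | (t : ℝ≥0∞) ≤ γ ω} := by
  have : (𝓝[<] t).NeBot := nhdsLT_neBot_of_exists_lt ⟨0, ht⟩
  refine leftLim_eq_of_tendsto ?_
  have hG : Gbar P γ = fun s : ℝ≥0 => ∫ ω, {ω | (s : ℝ≥0∞) < γ ω}.indicator (1 : Ω → ℝ) ω ∂P := by
    ext s
    rw [Gbar_eq hγ, integral_indicator_one (measurableSet_lt measurable_const hγ)]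
  rw [hG, ← integral_indicator_one (measurableSet_le measurable_const hγ)]
  refine tendsto_integral_filter_of_dominated_convergence (fun _ => 1) ?_ ?_
    (integrable_const 1) ?_
  · exact Eventually.of_forall fun s =>
      (measurable_one.indicator (measurableSet_lt measurable_const hγ)).aestronglyMeasurable
  · refine Eventually.of_forall fun s => ae_of_all _ fun ω => ?_
    simp only [indicator_apply]
    split_ifs <;> simp
  · refine ae_of_all _ fun ω => tendsto_const_nhds.congr' ?_
    rcases le_or_gt (t : ℝ≥0∞) (γ ω) with h | h
    · filter_upwards [self_mem_nhdsWithin] with s hs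
      have : (s : ℝ≥0∞) < γ ω := (ENNReal.coe_lt_coe.2 hs).trans_le h
      simp [h, this]
    · have hc : Tendsto (fun s : ℝ≥0 => (s : ℝ≥0∞)) (𝓝[<] t) (𝓝 (t : ℝ≥0∞)) :=
        (ENNReal.continuous_coe.tendsto t).mono_left nhdsWithin_le_nhds
      filter_upwards [hc.eventually_const_lt h] with s hs
      simp [h.not_ge, hs.not_gt]

/-- If `P(γ > u) > 0` for some `u > t`, then `G u < 1` and `u ≤ t_G ≤ t`, a contradiction; now let
`u ↓ t`. -/
theorem measure_lt_eq_zero_of_endpoint_le [IsProbabilityMeasure P] (hγ : Measurable γ) {t : ℝ≥0}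
    (ht : endpoint P γ ≤ t) : P {ω | (t : ℝ≥0∞) < γ ω} = 0 := by
  obtain ⟨u, -, hut, hu⟩ := exists_seq_strictAnti_tendsto t
  have hsub : {ω | (t : ℝ≥0∞) < γ ω} ⊆ ⋃ n, {ω | (u n : ℝ≥0∞) < γ ω} := by
    intro ω hω
    have hc : Tendsto (fun n => (u n : ℝ≥0∞)) atTop (𝓝 (t : ℝ≥0∞)) := ENNReal.tendsto_coe.2 hu
    exact mem_iUnion.2 (hc.eventually_lt_const hω).exists
  refine measure_mono_null hsub (measure_iUnion_null fun n => ?_)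
  by_contra h
  have h1 : 0 < Gbar P γ (u n) := by
    rw [Gbar_eq hγ]
    exact ENNReal.toReal_pos h (measure_ne_top _ _)
  have h2 : (u n : ℝ≥0∞) ≤ endpoint P γ := le_sSup ⟨u n, sub_pos.1 h1, rfl⟩
  exact (h2.trans ht).not_gt (ENNReal.coe_lt_coe.2 (hut n))

theorem endpoint_pos [IsProbabilityMeasure P] (hγ : Measurable γ) (h : 0 < P {ω | 0 < γ ω}) :
    0 < endpoint P γ := by
  by_contra h0
  refine h.ne' ?_
  simpa using measure_lt_eq_zero_of_endpoint_le (P := P) hγ (t := 0) (by simpa using h0)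

theorem mem_timeSet_of_lt_endpoint [IsProbabilityMeasure P] (hγ : Measurable γ) {t : ℝ≥0}
    (ht : (t : ℝ≥0∞) < endpoint P γ) : t ∈ timeSet P γ := by
  obtain ⟨_, ⟨s, hs, rfl⟩, hts⟩ := lt_sSup_iff.1 ht
  have h : 0 < Gbar P γ s := sub_pos.2 hs
  rw [Gbar_eq hγ] at h
  refine (ENNReal.toReal_pos_iff.1 h).1.trans_le (measure_mono fun ω hω => ?_)
  exact hts.le.trans (le_of_lt hω)

/-- If `t_G ≤ t`, then `{γ ≥ t}` lies in `{γ = t_G} ∪ {γ > t_G}`, and both are null in Case A. -/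
theorem lt_endpoint_of_mem_timeSet [IsProbabilityMeasure P] (hγ : Measurable γ) (hA : CaseA P γ)
    {t : ℝ≥0} (ht : t ∈ timeSet P γ) : (t : ℝ≥0∞) < endpoint P γ := by
  by_contra! h
  have hfin : endpoint P γ < ∞ := h.trans_lt ENNReal.coe_lt_top
  refine (ne_of_gt ht) (measure_mono_null (t := {ω | γ ω = endpoint P γ ∧ endpoint P γ < ∞} ∪
    {ω | ((endpoint P γ).toNNReal : ℝ≥0∞) < γ ω}) ?_ (measure_union_null hA
      (measure_lt_eq_zero_of_endpoint_le hγ (ENNReal.coe_toNNReal hfin.ne).ge)))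
  intro ω hω
  rcases (h.trans hω).eq_or_lt with h' | h'
  · exact Or.inl ⟨h'.symm, hfin⟩
  · exact Or.inr (by simpa [ENNReal.coe_toNNReal hfin.ne] using h')

end Law

/-! ### The primitive evaluated at `t ∧ γ`, and its mean by Fubini -/

section Compensator

variable {Ω : Type*} {mΩ : MeasurableSpace Ω} {P : Measure Ω} {γ : Ω → ℝ≥0∞} {V : Ω → ℝ}
  {K : ℝ≥0 → ℝ}

/-- The integrand of `primitive P γ K`. -/
noncomputable def integrand (P : Measure Ω) (γ : Ω → ℝ≥0∞) (K : ℝ≥0 → ℝ) (s : ℝ≥0) : ℝ :=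
  (Function.leftLim (Gbar P γ) s)⁻¹ * K s

/-- The integrand of `primitive P γ K`, cut off after the jump. -/
noncomputable def stoppedIntegrand (P : Measure Ω) (γ : Ω → ℝ≥0∞) (K : ℝ≥0 → ℝ) (ω : Ω) :
    ℝ≥0 → ℝ :=
  {s : ℝ≥0 | (s : ℝ≥0∞) ≤ γ ω}.indicator (integrand P γ K)

theorem measurable_integrand [IsProbabilityMeasure P] (hγ : Measurable γ) (hK : Measurable K) :
    Measurable (integrand P γ K) :=
  (antitone_Gbar hγ).leftLim.measurable.inv.mul hK

theorem integrand_eq [IsProbabilityMeasure P] (hγ : Measurable γ) {s : ℝ≥0} (hs : 0 < s) :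
    integrand P γ K s = (P.real {ω | (s : ℝ≥0∞) ≤ γ ω})⁻¹ * K s := by
  rw [integrand, leftLim_Gbar hγ hs]

/-- On `(0, t]` the weight `P(γ ≥ s)⁻¹` is at most `P(γ ≥ t)⁻¹`, which is finite as `t ∈ 𝒯`. -/
theorem integrableOn_integrand [IsProbabilityMeasure P] (hγ : Measurable γ)
    (hK : IsCondExpGiven P γ V K) {t : ℝ≥0} (ht : t ∈ timeSet P γ) :
    IntegrableOn (integrand P γ K) (Ioc 0 t) (dG P γ) := by
  refine (((hK.integrableOn t ht).mono_set Ioc_subset_Iic_self).const_mul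
    (P.real {ω | (t : ℝ≥0∞) ≤ γ ω})⁻¹).mono
    (measurable_integrand hγ hK.measurable).aestronglyMeasurable ?_
  refine (ae_restrict_iff' measurableSet_Ioc).2 (ae_of_all _ fun s hs => ?_)
  rw [integrand_eq hγ hs.1, norm_mul, norm_mul, norm_inv, norm_inv,
    Real.norm_of_nonneg measureReal_nonneg, Real.norm_of_nonneg measureReal_nonneg]
  have := measureReal_le_pos ht
  gcongr
  · exact measure_ne_top _ _
  · exact hs.2

theorem measurable_primitive [IsProbabilityMeasure P] (hγ : Measurable γ) (hK : Measurable K) :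
    Measurable (primitive P γ K) := by
  have := isFiniteMeasure_dG (P := P) hγ
  have h : primitive P γ K =
      fun t => ∫ s, {p : ℝ≥0 × ℝ≥0 | p.2 ∈ Ioc 0 p.1}.indicator
        (fun p => integrand P γ K p.2) (t, s) ∂(dG P γ) := by
    ext t
    rw [primitive, ← integral_indicator measurableSet_Ioc]
    rfl
  rw [h]
  refine (StronglyMeasurable.integral_prod_right' (Measurable.stronglyMeasurable ?_)).measurable
  refine ((measurable_integrand hγ hK).comp measurable_snd).indicator ?_
  have h1 : MeasurableSet {p : ℝ≥0 × ℝ≥0 | 0 < p.2} :=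
    measurableSet_lt measurable_const measurable_snd
  have h2 : MeasurableSet {p : ℝ≥0 × ℝ≥0 | p.2 ≤ p.1} :=
    measurableSet_le measurable_snd measurable_fst
  exact h1.inter h2

/-- Moving the random bound from the domain into the integrand leaves a fixed domain, to which
Fubini applies and which presents each path as an indefinite integral. -/
theorem primitive_min (t : ℝ≥0) (ω : Ω) : primitive P γ K (min (t : ℝ≥0∞) (γ ω)).toNNReal
    = ∫ s in Ioc 0 t, stoppedIntegrand P γ K ω s ∂(dG P γ) := by
  have hS : MeasurableSet {s : ℝ≥0 | (s : ℝ≥0∞) ≤ γ ω} :=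
    measurableSet_le measurable_coe_nnreal_ennreal measurable_const
  have hne : min (t : ℝ≥0∞) (γ ω) ≠ ∞ :=
    ne_top_of_le_ne_top ENNReal.coe_ne_top (min_le_left _ _)
  rw [stoppedIntegrand, setIntegral_indicator hS, primitive]
  congr 2
  ext s
  simp only [mem_Ioc, mem_inter_iff, mem_ofPred_eq]
  rw [← ENNReal.coe_le_coe (q := (min (t : ℝ≥0∞) (γ ω)).toNNReal), ENNReal.coe_toNNReal hne,
    le_min_iff, ENNReal.coe_le_coe, and_assoc]

theorem measurable_stoppedIntegrand [IsProbabilityMeasure P] (hγ : Measurable γ)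
    (hK : Measurable K) : Measurable fun p : Ω × ℝ≥0 => stoppedIntegrand P γ K p.1 p.2 := by
  refine Measurable.indicator (s := {p : Ω × ℝ≥0 | (p.2 : ℝ≥0∞) ≤ γ p.1})
    ((measurable_integrand hγ hK).comp measurable_snd) ?_
  exact measurableSet_le (measurable_coe_nnreal_ennreal.comp measurable_snd)
    (hγ.comp measurable_fst)

theorem lintegral_enorm_stoppedIntegrand [IsProbabilityMeasure P] (hγ : Measurable γ) {s : ℝ≥0}
    (hs : 0 < s) (hsT : s ∈ timeSet P γ) :
    ∫⁻ ω, ‖stoppedIntegrand P γ K ω s‖ₑ ∂P = ‖K s‖ₑ := by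
  have h : ∀ ω, ‖stoppedIntegrand P γ K ω s‖ₑ
      = {ω | (s : ℝ≥0∞) ≤ γ ω}.indicator (fun _ => ‖integrand P γ K s‖ₑ) ω := by
    intro ω
    by_cases hω : (s : ℝ≥0∞) ≤ γ ω <;> simp [stoppedIntegrand, hω]
  have hpos := measureReal_le_pos hsT
  simp_rw [h]
  rw [lintegral_indicator_const (measurableSet_le measurable_const hγ), integrand_eq hγ hs,
    ← ofReal_measureReal, ← Real.enorm_of_nonneg hpos.le, ← enorm_mul, mul_right_comm,
    inv_mul_cancel₀ hpos.ne', one_mul]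

/-- The stopped integrand is nonzero only on `{γ ≥ s}`, whose probability cancels the weight. -/
theorem integral_stoppedIntegrand [IsProbabilityMeasure P] (hγ : Measurable γ) {s : ℝ≥0}
    (hs : 0 < s) (hsT : s ∈ timeSet P γ) : ∫ ω, stoppedIntegrand P γ K ω s ∂P = K s := by
  have h : ∀ ω, stoppedIntegrand P γ K ω s
      = {ω | (s : ℝ≥0∞) ≤ γ ω}.indicator (fun _ => integrand P γ K s) ω := fun _ => rfl
  have hpos := measureReal_le_pos hsT
  simp_rw [h]
  rw [integral_indicator_const _ (measurableSet_le measurable_const hγ), integrand_eq hγ hs,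
    smul_eq_mul, mul_inv_cancel_left₀ hpos.ne']

theorem lintegral_lintegral_stoppedIntegrand [IsProbabilityMeasure P] (hγ : Measurable γ)
    (hK : Measurable K) {u : ℝ≥0} (hu : u ∈ timeSet P γ) :
    ∫⁻ ω, ∫⁻ s in Ioc 0 u, ‖stoppedIntegrand P γ K ω s‖ₑ ∂(dG P γ) ∂P
      = ∫⁻ s in Ioc 0 u, ‖K s‖ₑ ∂(dG P γ) := by
  have := isFiniteMeasure_dG (P := P) hγ
  rw [lintegral_lintegral_swap (measurable_stoppedIntegrand hγ hK).enorm.aemeasurable]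
  exact setLIntegral_congr_fun measurableSet_Ioc fun s hs =>
    lintegral_enorm_stoppedIntegrand hγ hs.1 (mem_timeSet_of_le hs.2 hu)

theorem integrable_prod_stoppedIntegrand [IsProbabilityMeasure P] (hγ : Measurable γ)
    (hK : IsCondExpGiven P γ V K) {u : ℝ≥0} (hu : u ∈ timeSet P γ) :
    Integrable (fun p : Ω × ℝ≥0 => stoppedIntegrand P γ K p.1 p.2)
      (P.prod ((dG P γ).restrict (Ioc 0 u))) := by
  have := isFiniteMeasure_dG (P := P) hγ
  have hm := measurable_stoppedIntegrand (P := P) hγ hK.measurable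
  refine ⟨hm.aestronglyMeasurable, ?_⟩
  rw [HasFiniteIntegral, lintegral_prod _ hm.enorm.aemeasurable,
    lintegral_lintegral_stoppedIntegrand hγ hK.measurable hu]
  exact ((hK.integrableOn u hu).mono_set Ioc_subset_Iic_self).2

theorem integrable_primitive_min [IsProbabilityMeasure P] (hγ : Measurable γ)
    (hK : IsCondExpGiven P γ V K) {u : ℝ≥0} (hu : u ∈ timeSet P γ) :
    Integrable (fun ω => primitive P γ K (min (u : ℝ≥0∞) (γ ω)).toNNReal) P := by
  have := isFiniteMeasure_dG (P := P) hγ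
  simp_rw [primitive_min]
  exact (integrable_prod_stoppedIntegrand hγ hK hu).integral_prod_left

theorem integral_primitive_min [IsProbabilityMeasure P] (hγ : Measurable γ)
    (hK : IsCondExpGiven P γ V K) {u : ℝ≥0} (hu : u ∈ timeSet P γ) :
    ∫ ω, primitive P γ K (min (u : ℝ≥0∞) (γ ω)).toNNReal ∂P = ∫ s in Ioc 0 u, K s ∂(dG P γ) := by
  have := isFiniteMeasure_dG (P := P) hγ
  simp_rw [primitive_min]
  rw [integral_integral_swap (integrable_prod_stoppedIntegrand hγ hK hu)]
  exact setIntegral_congr_fun measurableSet_Ioc fun s hs =>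
    integral_stoppedIntegrand hγ hs.1 (mem_timeSet_of_le hs.2 hu)

/-- The defining identity of `K` integrates over `[0, u]`; the point `0` contributes nothing because
`V = 0` on `{γ = 0}`. -/
theorem integral_jumpProcess [IsProbabilityMeasure P] (hγ : Measurable γ)
    (hV_zero : ∀ ω, γ ω = 0 → V ω = 0) (hK : IsCondExpGiven P γ V K) {u : ℝ≥0}
    (hu : u ∈ timeSet P γ) :
    ∫ ω, jumpProcess γ V u ω ∂P = ∫ s in Ioc 0 u, K s ∂(dG P γ) := by
  have h0 : ∫ s in Iic 0, K s ∂(dG P γ) = 0 := by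
    rw [← hK.setIntegral_eq 0 zero_mem_timeSet]
    exact setIntegral_eq_zero_of_forall_eq_zero fun ω hω => hV_zero ω (by simpa using hω)
  have hint := hK.integrableOn u hu
  rw [← Iic_union_Ioc_eq_Iic (zero_le (a := u))] at hint
  unfold jumpProcess
  rw [integral_indicator (measurableSet_le hγ measurable_const), hK.setIntegral_eq u hu,
    ← Iic_union_Ioc_eq_Iic (zero_le (a := u)), setIntegral_union (Iic_disjoint_Ioc le_rfl)
    measurableSet_Ioc hint.left_of_union hint.right_of_union, h0, zero_add]

end Compensator

/-! ### Zero mean implies the martingale property -/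

section Martingale

variable {Ω : Type*} {mΩ : MeasurableSpace Ω} {P : Measure Ω} {γ : Ω → ℝ≥0∞}

theorem jumpProcess_min {V : Ω → ℝ} {t u : ℝ≥0} {ω : Ω} (h : γ ω ≤ u) :
    jumpProcess γ V t ω = jumpProcess γ V (min t u) ω := by
  simp [jumpProcess, indicator_apply, h]

theorem min_coe_min {t u : ℝ≥0} {ω : Ω} (h : γ ω ≤ u) :
    min ((min t u : ℝ≥0) : ℝ≥0∞) (γ ω) = min (t : ℝ≥0∞) (γ ω) := by
  rw [ENNReal.coe_min, min_assoc, min_eq_right h]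

theorem toNNReal_min_le (t : ℝ≥0) (ω : Ω) : (min (t : ℝ≥0∞) (γ ω)).toNNReal ≤ t :=
  ENNReal.coe_le_coe.1 (ENNReal.coe_toNNReal_le_self.trans (min_le_left _ _))

theorem coe_toNNReal_min_le (t : ℝ≥0) (ω : Ω) :
    ((min (t : ℝ≥0∞) (γ ω)).toNNReal : ℝ≥0∞) ≤ γ ω :=
  ENNReal.coe_toNNReal_le_self.trans (min_le_right _ _)

/-- An adapted process which is constant from the jump on and has mean zero up to the time `u` is,
up to that time, a martingale closed by its value at `u`. -/
theorem ae_eq_condExp_of_integral_eq_zero [IsProbabilityMeasure P]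
    {M : ℝ≥0 → Ω → ℝ} (hM : StronglyAdapted (filtration (mΩ := mΩ) γ) M) {s u : ℝ≥0}
    (hs : Integrable (M s) P) (hu : Integrable (M u) P)
    (hs0 : ∫ ω, M s ω ∂P = 0) (hu0 : ∫ ω, M u ω ∂P = 0) (heq : ∀ ω, γ ω ≤ s → M u ω = M s ω) :
    M s =ᵐ[P] P[M u | filtration (mΩ := mΩ) γ s] := by
  refine ae_eq_condExp_of_forall_setIntegral_eq ((filtration γ).le s) hu
    (fun _ _ _ => hs.integrableOn) (fun B hB _ => ?_) (hM s).aestronglyMeasurable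
  rw [← sub_eq_zero, ← integral_sub hs.integrableOn hu.integrableOn]
  have hzero : ∀ ω, ¬ (s : ℝ≥0∞) < γ ω → M s ω - M u ω = 0 := fun ω hω => by
    rw [heq ω (not_lt.1 hω), sub_self]
  -- The increment lives on `{s < γ}`: if `B` misses this event its integral over `B` is `0`,
  -- otherwise it is the whole mean, again `0`.
  rcases hB.2 with h | h
  · exact setIntegral_eq_zero_of_forall_eq_zero fun ω hω => hzero ω fun hlt =>
      (eq_empty_iff_forall_notMem.1 h) ω ⟨hω, hlt⟩
  · rw [setIntegral_eq_integral_of_forall_compl_eq_zero fun ω hω => hzero ω fun hlt =>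
      hω (inter_eq_right.1 h hlt), integral_sub hs hu, hs0, hu0, sub_zero]

theorem martingale_min_of_integral_eq_zero [IsProbabilityMeasure P]
    {M : ℝ≥0 → Ω → ℝ} (hM : StronglyAdapted (filtration (mΩ := mΩ) γ) M) {u : ℝ≥0}
    (hint : ∀ t ≤ u, Integrable (M t) P) (hzero : ∀ t ≤ u, ∫ ω, M t ω ∂P = 0)
    (heq : ∀ (t : ℝ≥0) ω, γ ω ≤ t → t ≤ u → M u ω = M t ω) :
    Martingale (fun t => M (min t u)) (filtration (mΩ := mΩ) γ) P ∧
      UniformIntegrable (fun t => M (min t u)) 1 P := by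
  have hadap : StronglyAdapted (filtration (mΩ := mΩ) γ) fun t => M (min t u) := fun t =>
    (hM (min t u)).mono ((filtration γ).mono (min_le_left t u))
  have key : ∀ t, P[M u | filtration (mΩ := mΩ) γ t] =ᵐ[P] M (min t u) := by
    intro t
    rcases le_total t u with h | h
    · rw [min_eq_left h]
      exact (ae_eq_condExp_of_integral_eq_zero hM (hint t h) (hint u le_rfl) (hzero t h)
        (hzero u le_rfl) fun ω hω => heq t ω hω h).symm
    · rw [min_eq_right h, condExp_of_stronglyMeasurable ((filtration γ).le t)
        ((hM u).mono ((filtration γ).mono h)) (hint u le_rfl)]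
  refine ⟨⟨hadap, fun s t hst => ?_⟩, ?_⟩
  · exact (condExp_congr_ae (key t).symm).trans
      ((condExp_condExp_of_le ((filtration γ).mono hst) ((filtration γ).le t)).trans (key s))
  -- All stopped values are conditional expectations of the single integrable variable `M u`.
  · exact (uniformIntegrable_congr_ae key).1
      ((hint u le_rfl).uniformIntegrable_condExp_filtration (f := filtration γ))

end Martingale

/-! ### Local integrability of both processes, and the compensator property -/

section Compensator

variable {Ω : Type*} {mΩ : MeasurableSpace Ω} {P : Measure Ω} {γ : Ω → ℝ≥0∞} {V : Ω → ℝ}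
  {K : ℝ≥0 → ℝ}

/-- Lets the results on indefinite integrals apply to the jump process. As `(0, t]` omits `0`, a
jump at `0` is only covered because `V` vanishes there. -/
theorem jumpProcess_eq_integral_dirac (hV_zero : ∀ ω, γ ω = 0 → V ω = 0) (t : ℝ≥0) {ω : Ω}
    (hω : γ ω ≠ ∞) :
    jumpProcess γ V t ω = ∫ _ in Ioc 0 t, V ω ∂(Measure.dirac (γ ω).toNNReal) := by
  have hle : (γ ω).toNNReal ≤ t ↔ γ ω ≤ t := by
    rw [← ENNReal.coe_le_coe, ENNReal.coe_toNNReal hω]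
  rw [← integral_indicator measurableSet_Ioc, integral_dirac]
  rcases eq_or_ne (γ ω) 0 with h | h
  · simp [jumpProcess, h, hV_zero ω h]
  · have : 0 < (γ ω).toNNReal := ENNReal.toNNReal_pos h hω
    simp [jumpProcess, indicator_apply, this, hle]

/-- The paths of the single jump process are indefinite integrals. -/
theorem exists_jumpProcess_eq_integral (hV_zero : ∀ ω, γ ω = 0 → V ω = 0) (ω : Ω) :
    ∃ μ : Measure ℝ≥0, IsFiniteMeasure μ ∧
      (∀ t, jumpProcess γ V t ω = ∫ _ in Ioc 0 t, V ω ∂μ) ∧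
      ∀ t, ∫⁻ _ in Ioc 0 t, ‖V ω‖ₑ ∂μ ≤ ‖(jumpProcess γ V t ω)‖ₑ := by
  rcases eq_or_ne (γ ω) ∞ with h | h
  · exact ⟨0, inferInstance, fun t => by simp [jumpProcess, h], fun t => by simp⟩
  · refine ⟨Measure.dirac (γ ω).toNNReal, inferInstance, fun t =>
      jumpProcess_eq_integral_dirac hV_zero t h, fun t => ?_⟩
    rw [← lintegral_indicator measurableSet_Ioc, lintegral_dirac]
    have hle : (γ ω).toNNReal ≤ t ↔ γ ω ≤ t := by
      rw [← ENNReal.coe_le_coe, ENNReal.coe_toNNReal h]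
    by_cases ht : γ ω ≤ t
    · rw [jumpProcess, indicator_of_mem (s := {ω | γ ω ≤ t}) ht]
      exact indicator_le_self _ _ _
    · simp [hle, ht]

theorem integrable_jumpProcess (hγ : Measurable γ) {u : ℝ≥0}
    (hV : IntegrableOn V {ω | γ ω ≤ u} P) : Integrable (jumpProcess γ V u) P :=
  (integrable_indicator_iff (measurableSet_le hγ measurable_const)).2 hV

/-- Up to `t n` the variation of a path is at most `|X_{t n}|`, which is integrable since `t n ∈ 𝒯`.
-/
theorem isLocallyIntegrableVariation_jumpProcess [IsProbabilityMeasure P] (hγ : Measurable γ)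
    (hV : Measurable V) (hV_zero : ∀ ω, γ ω = 0 → V ω = 0)
    (hV_int : ∀ t ∈ timeSet P γ, IntegrableOn V {ω | γ ω ≤ t} P) :
    IsLocallyIntegrableVariation (filtration (mΩ := mΩ) γ) P (jumpProcess γ V) := by
  have hpath := exists_jumpProcess_eq_integral hV_zero
  obtain ⟨t, hmono, htT, hcof⟩ := exists_monotone_cofinal_timeSet (P := P) (γ := γ)
  refine ⟨⟨stronglyAdapted_jumpProcess hγ hV, ae_of_all _ fun ω => ?_, ae_of_all _ fun ω => ?_⟩,
    fun n => cutTime γ (t n), isLocalizingSequence_cutTime hγ hmono ?_, fun n => ?_⟩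
  · obtain ⟨μ, _, hμ, -⟩ := hpath ω
    simp_rw [hμ]
    exact isCadlag_setIntegral_Ioc fun _ => integrable_const _
  · obtain ⟨μ, _, hμ, -⟩ := hpath ω
    simp_rw [hμ]
    exact locallyBoundedVariationOn_setIntegral_Ioc fun _ => integrable_const _
  · filter_upwards [ae_forall_le_mem_timeSet] with ω hω s hs using hcof s (hω s hs)
  · rw [stoppedProcess_cutTime fun s ω hω => jumpProcess_min hω]
    refine lt_of_le_of_lt (lintegral_mono fun ω => ?_)
      (integrable_jumpProcess hγ (hV_int _ (htT n))).2
    obtain ⟨μ, _, hμ, hle⟩ := hpath ω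
    have h0 : jumpProcess γ V 0 ω = 0 := by simp [hμ]
    rw [h0, enorm_zero, zero_add]
    refine le_trans ?_ (hle (t n))
    simp_rw [hμ]
    exact eVariationOn_setIntegral_Ioc_min_le (fun _ => integrable_const _) _

variable {H : ℝ≥0 → ℝ}

theorem integrableOn_stoppedIntegrand [IsProbabilityMeasure P] (hγ : Measurable γ)
    (hK : IsCondExpGiven P γ V K) {ω : Ω} (hω : ∀ s : ℝ≥0, (s : ℝ≥0∞) ≤ γ ω → s ∈ timeSet P γ)
    (t : ℝ≥0) : IntegrableOn (stoppedIntegrand P γ K ω) (Ioc 0 t) (dG P γ) := by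
  have hS : MeasurableSet {s : ℝ≥0 | (s : ℝ≥0∞) ≤ γ ω} :=
    measurableSet_le measurable_coe_nnreal_ennreal measurable_const
  rw [stoppedIntegrand, integrableOn_indicator_iff hS]
  refine (integrableOn_integrand hγ hK (hω _ (coe_toNNReal_min_le t ω))).mono_set ?_
  rintro s ⟨hs, hs0, hst⟩
  refine ⟨hs0, ?_⟩
  rw [← ENNReal.coe_le_coe, ENNReal.coe_toNNReal
    (ne_top_of_le_ne_top ENNReal.coe_ne_top (min_le_left _ _))]
  exact le_min (ENNReal.coe_le_coe.2 hst) hs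

theorem comp_min_eq_integral (hH : ∀ t ∈ timeSet P γ, H t = primitive P γ K t) {ω : Ω}
    {t : ℝ≥0} (ht : (min (t : ℝ≥0∞) (γ ω)).toNNReal ∈ timeSet P γ) :
    H (min (t : ℝ≥0∞) (γ ω)).toNNReal
      = ∫ s in Ioc 0 t, stoppedIntegrand P γ K ω s ∂(dG P γ) := by
  rw [hH _ ht, primitive_min]

/-- By Tonelli, the expected variation up to `t n` is at most `∫_{(0, t n]} |K| dG`. -/
theorem isLocallyIntegrableVariation_comp_min [IsProbabilityMeasure P] (hγ : Measurable γ)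
    (hK : IsCondExpGiven P γ V K) (hHm : Measurable H)
    (hH : ∀ t ∈ timeSet P γ, H t = primitive P γ K t) :
    IsLocallyIntegrableVariation (filtration (mΩ := mΩ) γ) P
      fun t ω => H (min (t : ℝ≥0∞) (γ ω)).toNNReal := by
  obtain ⟨t, hmono, htT, hcof⟩ := exists_monotone_cofinal_timeSet (P := P) (γ := γ)
  refine ⟨⟨(isStronglyPredictable_comp_min hγ hHm).stronglyAdapted, ?_, ?_⟩,
    fun n => cutTime γ (t n), isLocalizingSequence_cutTime hγ hmono ?_, fun n => ?_⟩
  · filter_upwards [ae_forall_le_mem_timeSet] with ω hω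
    simp_rw [comp_min_eq_integral hH (hω _ (coe_toNNReal_min_le _ ω))]
    exact isCadlag_setIntegral_Ioc (integrableOn_stoppedIntegrand hγ hK hω)
  · filter_upwards [ae_forall_le_mem_timeSet] with ω hω
    simp_rw [comp_min_eq_integral hH (hω _ (coe_toNNReal_min_le _ ω))]
    exact locallyBoundedVariationOn_setIntegral_Ioc (integrableOn_stoppedIntegrand hγ hK hω)
  · filter_upwards [ae_forall_le_mem_timeSet] with ω hω s hs using hcof s (hω s hs)
  · rw [stoppedProcess_cutTime fun s ω hω => by rw [min_coe_min hω]]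
    have hfin := lintegral_lintegral_stoppedIntegrand hγ hK.measurable (htT n)
    refine lt_of_le_of_lt (lintegral_mono_ae ?_) (hfin.trans_lt
      ((hK.integrableOn _ (htT n)).mono_set Ioc_subset_Iic_self).2)
    filter_upwards [ae_forall_le_mem_timeSet] with ω hω
    simp_rw [comp_min_eq_integral hH (hω _ (coe_toNNReal_min_le _ ω))]
    rw [Ioc_self, setIntegral_empty, enorm_zero, zero_add]
    exact eVariationOn_setIntegral_Ioc_min_le (integrableOn_stoppedIntegrand hγ hK hω) _

theorem IsCadlag.sub {f g : ℝ≥0 → ℝ} (hf : IsCadlag f) (hg : IsCadlag g) :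
    IsCadlag fun t => f t - g t := by
  refine ⟨fun t => (hf.1 t).sub (hg.1 t), fun t => ?_⟩
  obtain ⟨l, hl⟩ := hf.2 t
  obtain ⟨m, hm⟩ := hg.2 t
  exact ⟨l - m, hl.sub hm⟩

/-- If a Borel function `H` agrees with `primitive P γ K` on `timeSet P γ`, then `H(t ∧ γ)` is the
compensator of the single jump process. -/
theorem isCompensator_comp_min [IsProbabilityMeasure P] (hγ : Measurable γ)
    (hV : Measurable V) (hV_zero : ∀ ω, γ ω = 0 → V ω = 0)
    (hV_int : ∀ t ∈ timeSet P γ, IntegrableOn V {ω | γ ω ≤ t} P)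
    (hK : IsCondExpGiven P γ V K) (hHm : Measurable H)
    (hH : ∀ t ∈ timeSet P γ, H t = primitive P γ K t) :
    IsCompensator (filtration (mΩ := mΩ) γ) P (jumpProcess γ V)
      fun t ω => H (min (t : ℝ≥0∞) (γ ω)).toNNReal := by
  have hX := isLocallyIntegrableVariation_jumpProcess hγ hV hV_zero hV_int
  have hA := isLocallyIntegrableVariation_comp_min hγ hK hHm hH
  have hadap : StronglyAdapted (filtration (mΩ := mΩ) γ) fun t ω =>
      jumpProcess γ V t ω - H (min (t : ℝ≥0∞) (γ ω)).toNNReal := fun t =>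
    (hX.adapted t).sub (hA.adapted t)
  obtain ⟨t, hmono, htT, hcof⟩ := exists_monotone_cofinal_timeSet (P := P) (γ := γ)
  refine ⟨hX, isStronglyPredictable_comp_min hγ hHm, hA, ae_of_all _ fun ω => ?_, hadap, ?_,
    fun n => cutTime γ (t n), isLocalizingSequence_cutTime hγ hmono ?_, fun n => ?_⟩
  · have h0 : H 0 = 0 := by simp [hH 0 zero_mem_timeSet, primitive]
    by_cases h : γ ω = 0
    · simp [jumpProcess, h, h0, hV_zero ω h]
    · simp [jumpProcess, h, h0]
  · filter_upwards [hX.cadlag, hA.cadlag] with ω h h' using h.sub h'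
  · filter_upwards [ae_forall_le_mem_timeSet] with ω hω s hs using hcof s (hω s hs)
  · rw [stoppedProcess_cutTime fun s ω hω => by rw [min_coe_min hω, jumpProcess_min hω]]
    have hHe : ∀ s ≤ t n, (fun ω => H (min (s : ℝ≥0∞) (γ ω)).toNNReal)
        = fun ω => primitive P γ K (min (s : ℝ≥0∞) (γ ω)).toNNReal := fun s hs =>
      funext fun ω => hH _ (mem_timeSet_of_le ((toNNReal_min_le s ω).trans hs) (htT n))
    have hiX : ∀ s ≤ t n, Integrable (jumpProcess γ V s) P := fun s hs =>
      integrable_jumpProcess hγ (hV_int s (mem_timeSet_of_le hs (htT n)))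
    have hiA : ∀ s ≤ t n, Integrable (fun ω => H (min (s : ℝ≥0∞) (γ ω)).toNNReal) P :=
      fun s hs => by
        rw [hHe s hs]
        exact integrable_primitive_min hγ hK (mem_timeSet_of_le hs (htT n))
    refine martingale_min_of_integral_eq_zero hadap (fun s hs => (hiX s hs).sub (hiA s hs))
      (fun s hs => ?_) fun s ω hω hs => ?_
    · have hsT := mem_timeSet_of_le hs (htT n)
      rw [integral_sub (hiX s hs) (hiA s hs), hHe s hs, integral_primitive_min hγ hK hsT,
        integral_jumpProcess hγ hV_zero hK hsT, sub_self]
    · rw [jumpProcess_min (t := t n) hω, min_eq_right hs, min_eq_right hω,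
        min_eq_right (hω.trans (ENNReal.coe_le_coe.2 hs))]

end Compensator

/-! ### Cases A and B: behaviour at the right endpoint -/

section Cases

variable {Ω : Type*} {mΩ : MeasurableSpace Ω} {P : Measure Ω} {γ : Ω → ℝ≥0∞} {V : Ω → ℝ}
  {K : ℝ≥0 → ℝ}

theorem F_of_lt {t : ℝ≥0} (ht : (t : ℝ≥0∞) < endpoint P γ) : F P γ K t = primitive P γ K t :=
  if_pos ht

theorem measurable_F [IsProbabilityMeasure P] (hγ : Measurable γ) (hK : Measurable K) :
    Measurable (F P γ K) :=
  Measurable.ite (measurableSet_lt measurable_coe_nnreal_ennreal measurable_const)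
    (measurable_primitive hγ hK) measurable_const

theorem CaseB.endpoint_lt_top (hB : CaseB P γ) : endpoint P γ < ∞ := by
  by_contra h
  simp [CaseB, h] at hB

theorem CaseB.endpoint_mem_timeSet (hB : CaseB P γ) : (endpoint P γ).toNNReal ∈ timeSet P γ := by
  refine lt_of_lt_of_le hB (measure_mono fun ω hω => ?_)
  simpa [ENNReal.coe_toNNReal hω.2.ne] using hω.1.ge

theorem CaseB.tendsto_primitive [IsProbabilityMeasure P] (hγ : Measurable γ) (hB : CaseB P γ)
    (hK : IsCondExpGiven P γ V K) :
    Tendsto (primitive P γ K) (𝓝[<] (endpoint P γ).toNNReal)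
      (𝓝 (∫ s in Ioo 0 (endpoint P γ).toNNReal, integrand P γ K s ∂(dG P γ))) :=
  tendsto_setIntegral_Ioc_left (integrableOn_integrand hγ hK hB.endpoint_mem_timeSet)

theorem CaseB.F_endpoint [IsProbabilityMeasure P] (hγ : Measurable γ)
    (hpos : 0 < P {ω | 0 < γ ω}) (hB : CaseB P γ) (hK : IsCondExpGiven P γ V K) :
    F P γ K (endpoint P γ).toNNReal
      = ∫ s in Ioo 0 (endpoint P γ).toNNReal, integrand P γ K s ∂(dG P γ) := by
  -- The limit defining `F` is determined only because `t_G > 0`, which comes from `P(γ > 0) > 0`.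
  have : (𝓝[<] (endpoint P γ).toNNReal).NeBot := nhdsLT_neBot_of_exists_lt
    ⟨0, ENNReal.toNNReal_pos (endpoint_pos hγ hpos).ne' hB.endpoint_lt_top.ne⟩
  rw [F, if_neg (by simp [ENNReal.coe_toNNReal hB.endpoint_lt_top.ne]), if_pos hB]
  exact (hB.tendsto_primitive hγ hK).limUnder_eq

theorem CaseB.tendsto_F [IsProbabilityMeasure P] (hγ : Measurable γ)
    (hpos : 0 < P {ω | 0 < γ ω}) (hB : CaseB P γ) (hK : IsCondExpGiven P γ V K) :
    Tendsto (F P γ K) (𝓝[<] (endpoint P γ).toNNReal)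
      (𝓝 (F P γ K (endpoint P γ).toNNReal)) := by
  rw [hB.F_endpoint hγ hpos hK]
  refine (hB.tendsto_primitive hγ hK).congr' ?_
  filter_upwards [self_mem_nhdsWithin] with t ht
  refine (F_of_lt ?_).symm
  rw [← ENNReal.coe_toNNReal hB.endpoint_lt_top.ne]
  exact ENNReal.coe_lt_coe.2 ht

/-- At the right endpoint, in Case B, the integrand times the mass of the endpoint is `K`. -/
theorem CaseB.primitive_endpoint [IsProbabilityMeasure P] (hγ : Measurable γ)
    (hpos : 0 < P {ω | 0 < γ ω}) (hB : CaseB P γ) (hK : IsCondExpGiven P γ V K) :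
    primitive P γ K (endpoint P γ).toNNReal
      = F P γ K (endpoint P γ).toNNReal + K (endpoint P γ).toNNReal := by
  have he : ((endpoint P γ).toNNReal : ℝ≥0∞) = endpoint P γ :=
    ENNReal.coe_toNNReal hB.endpoint_lt_top.ne
  have hmem := hB.endpoint_mem_timeSet
  have ha : 0 < (endpoint P γ).toNNReal :=
    ENNReal.toNNReal_pos (endpoint_pos hγ hpos).ne' hB.endpoint_lt_top.ne
  rw [hB.F_endpoint hγ hpos hK]
  generalize (endpoint P γ).toNNReal = a at *
  -- Since `P(γ > t_G) = 0`, the atom at `t_G` has mass `Ḡ(t_G-)`, the reciprocal of the weight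
  -- there.
  have hmass : P.real {ω | γ ω = a} = P.real {ω | (a : ℝ≥0∞) ≤ γ ω} := by
    have hnull := measure_lt_eq_zero_of_endpoint_le (P := P) hγ he.ge
    refine congrArg ENNReal.toReal (measure_congr ?_)
    filter_upwards [measure_eq_zero_iff_ae_notMem.1 hnull] with ω hω
    refine propext ⟨fun h => ge_of_eq h, fun h => ?_⟩
    exact le_antisymm (not_lt.1 hω) h
  have hint := integrableOn_integrand hγ hK hmem
  change ∫ s in Ioc 0 a, integrand P γ K s ∂(dG P γ) = _
  rw [← Ioo_union_right ha] at hint ⊢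
  rw [setIntegral_union (by simp) (measurableSet_singleton a) hint.left_of_union
    hint.right_of_union, integral_singleton, integrand_eq hγ ha, measureReal_def, dG_singleton hγ,
    ← measureReal_def, hmass, smul_eq_mul, mul_inv_cancel_left₀ (measureReal_le_pos hmem).ne']

/-- Adding the jump `K(t_G)` undoes the replacement of the primitive at `t_G` by its left limit;
times beyond `t_G` are not in `𝒯`. -/
theorem CaseB.F_add_eq_primitive [IsProbabilityMeasure P] (hγ : Measurable γ)
    (hpos : 0 < P {ω | 0 < γ ω}) (hB : CaseB P γ) (hK : IsCondExpGiven P γ V K) {t : ℝ≥0}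
    (ht : t ∈ timeSet P γ) :
    F P γ K t + {s : ℝ≥0 | endpoint P γ ≤ s}.indicator (fun _ => K (endpoint P γ).toNNReal) t
      = primitive P γ K t := by
  rcases lt_trichotomy (t : ℝ≥0∞) (endpoint P γ) with h | h | h
  · simp [F_of_lt h, h.not_ge]
  · have h' : t = (endpoint P γ).toNNReal := by rw [← h, ENNReal.toNNReal_coe]
    rw [indicator_of_mem (s := {s : ℝ≥0 | endpoint P γ ≤ s}) h.ge, h',
      hB.primitive_endpoint hγ hpos hK]
  · refine absurd (measure_mono_null (fun ω hω => ?_)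
      (measure_lt_eq_zero_of_endpoint_le (P := P) hγ
        (ENNReal.coe_toNNReal hB.endpoint_lt_top.ne).ge)) (ne_of_gt ht)
    rw [mem_ofPred_eq, ENNReal.coe_toNNReal hB.endpoint_lt_top.ne]
    exact h.trans_le hω

/-- The product `1_{γ ≥ t_G} 1_{t ≥ t_G}` is `1_{t ∧ γ ≥ t_G}`, so the process is a function of `t ∧
γ` alone, and hence predictable. -/
theorem compensatorB_eq :
    compensatorB P γ K = fun (t : ℝ≥0) ω => (fun t => F P γ K t +
      {s : ℝ≥0 | endpoint P γ ≤ s}.indicator (fun _ => K (endpoint P γ).toNNReal) t)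
        (min (t : ℝ≥0∞) (γ ω)).toNNReal := by
  ext t ω
  have hmin : ((min (t : ℝ≥0∞) (γ ω)).toNNReal : ℝ≥0∞) = min (t : ℝ≥0∞) (γ ω) :=
    ENNReal.coe_toNNReal (ne_top_of_le_ne_top ENNReal.coe_ne_top (min_le_left _ _))
  by_cases h1 : endpoint P γ ≤ t <;> by_cases h2 : endpoint P γ ≤ γ ω <;>
    simp [compensatorB, hmin, h1, h2]

end Cases

end SingleJump

theorem theorem5 {Ω : Type*} [mΩ : MeasurableSpace Ω] (P : Measure Ω) [IsProbabilityMeasure P]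
    (γ : Ω → ℝ≥0∞) (hγ : Measurable γ) (hγ_pos : 0 < P {ω | 0 < γ ω})
    (V : Ω → ℝ) (hV : Measurable V) (hV_zero : ∀ ω, γ ω = 0 → V ω = 0)
    (hV_int : ∀ t ∈ SingleJump.timeSet P γ, IntegrableOn V {ω | γ ω ≤ t} P)
    (K : ℝ≥0 → ℝ) (hK : SingleJump.IsCondExpGiven P γ V K) :
    (∀ t : ℝ≥0, (t : ℝ≥0∞) < SingleJump.endpoint P γ →
      IntegrableOn (fun s => (Function.leftLim (SingleJump.Gbar P γ) s)⁻¹ * K s) (Ioc 0 t)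
        (SingleJump.dG P γ)) ∧
    (SingleJump.CaseA P γ →
      SingleJump.IsCompensator (SingleJump.filtration γ) P
        (SingleJump.jumpProcess γ V) (SingleJump.compensatorA P γ K)) ∧
    (SingleJump.CaseB P γ →
      Tendsto (SingleJump.F P γ K) (𝓝[<] (SingleJump.endpoint P γ).toNNReal)
        (𝓝 (SingleJump.F P γ K (SingleJump.endpoint P γ).toNNReal)) ∧
      SingleJump.IsCompensator (SingleJump.filtration γ) P
        (SingleJump.jumpProcess γ V) (SingleJump.compensatorB P γ K)) := by
  have hm : Measurable K := hK.measurable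
  refine ⟨fun t ht => SingleJump.integrableOn_integrand hγ hK
      (SingleJump.mem_timeSet_of_lt_endpoint hγ ht), fun hA => ?_, fun hB =>
      ⟨hB.tendsto_F hγ hγ_pos hK, ?_⟩⟩
  · exact SingleJump.isCompensator_comp_min hγ hV hV_zero hV_int hK
      (SingleJump.measurable_F hγ hm) fun t ht =>
        SingleJump.F_of_lt (SingleJump.lt_endpoint_of_mem_timeSet hγ hA ht)
  · rw [SingleJump.compensatorB_eq]
    refine SingleJump.isCompensator_comp_min hγ hV hV_zero hV_int hK
      ((SingleJump.measurable_F hγ hm).add (measurable_const.indicator ?_)) fun t ht =>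
        hB.F_add_eq_primitive hγ hγ_pos hK ht
    exact measurableSet_le measurable_const measurable_coe_nnreal_ennreal
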